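/- Let $G$ be a finite set of priority groups and $C$ a finite set of schools. A type is a pair $(g,\succ)$ of a group $g\in G$ and a strict preference order $\succ$ over $C\cup\{\emptyset\}$, where $\emptyset$ means being unassigned; let $T$ be the finite set of all types. For every number $n$ of students there are given capacities $q^n_c\in\mathbb{Z}_{+}$ ($c\in C$), a budget $B^n\in\mathbb{Z}_{+}$, real penalties $r_{s,\emptyset}$ for leaving student $s$ unassigned (they may depend on $n$, on the student and on the profile of types), and for every school $c$ a strict total order on pairs (group, lottery number in $[0,1]$) in which, inside each group, a higher lottery number is better. A profile of types $\mathbf t\in T^n$ and a profile of pairwise distinct lottery numbers $\mathbf l\in[0,1]^n$ thus determine strict student preferences $\succ_s$ and strict school priorities $\succ_c$. A matching for capacities $q$ assigns each student $s$ to $\emptyset$ or to a school $c$ with $c\succ_s\emptyset$, at most $q_c$ students to each $c$. It is stable if there is no pair $(s,c)$ with $c\succ_s\emptyset$ such that $s$ strictly prefers $c$ to her assignment and either $c$ has fewer than $q_c$ students or $c$ ranks $s$ above one of its students. The capacity expansion problem is to choose $(x_c)_{c\in C}\in\mathbb{Z}_{+}^{C}$ with $\sum_c x_c\le B^n$ and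 a stable matching $\mu$ for the capacities $q^n+x$ so as to minimize $\sum_{s}r_{s,\mu(s)}$, where $r_{s,c}$ is the rank of $c$ in $\succ_s$ (the top choice has rank $1$) and $r_{s,\emptyset}$ is the penalty. A capacity-planning mechanism returns, for each $n$, $\mathbf t$ and $\mathbf l$, a (possibly degenerate) lottery over matchings, measurable in $\mathbf l$, such that whenever the numbers in $\mathbf l$ are pairwise distinct the lottery is supported on matchings that belong to optimal solutions of the capacity expansion problem and the choice among optimal solutions does not depend on the names of the students (permuting the students together with their types and lottery numbers permutes the lottery accordingly). Drawing $\mathbf l$ independently and uniformly from $[0,1]$ gives the direct mechanism $\Phi^n:T^n\to\Delta\big((C\cup\{\emptyset\})^n\big)$. For a probability distribution $m$ on $T$ let $\phi^n_i(t,m)\in\Delta(C\cup\{\emptyset\})$ be the lottery faced by student $i$ if she reports $t$ and the other $n-1$ reports are i.i.d. from $m$. For each type $t=(g,\succ)$ let $u_t:C\cup\{\emptyset\}\to\mathbb{R}$ be a utility function that represents $\succ$, extended to lotteries by expectation. Then every capacity-planning mechanism is semi-anonymous (permuting the students' types in $\Phi^n$ permutes the lottery over outcomes accordingly) and strategy-proof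 in the large: for every full-support probability distribution $m$ on $T$ and every $\varepsilon>0$ there is $n_0$ such that for all $n\ge n_0$, all students $i$, and all types $t,t'\in T$ of the same group, $$u_t\big[\phi^n_i(t,m)\big]\ \ge\ u_t\big[\phi^n_i(t',m)\big]-\varepsilon .$$ -/

import Mathlib

open MeasureTheory
open scoped unitInterval

/-! ### Direct mechanisms and strategy-proofness in the large -/

/-- A direct mechanism: for every number `n` of participants, a map from profiles of
reported types to lotteries over profiles of individual outcomes. -/
abbrev DirectMechanism (T O : Type*) := (n : ℕ) → (Fin n → T) → PMF (Fin n → O)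

/-- The law of a profile of `n` types drawn independently from `m`. -/
noncomputable def iidProfile {T : Type*} [Fintype T] (m : PMF T) (n : ℕ) :
    PMF (Fin n → T) :=
  PMF.ofFintype (fun τ => ∏ j, m (τ j)) (by
    classical
    rw [← Fintype.piFinset_univ, ← Finset.prod_univ_sum]
    have h : ∑ t, m t = 1 := by rw [← tsum_fintype (L := .unconditional T)]; exact m.tsum_coe
    simp [h])

/-- Expected utility of a lottery over a finite set of outcomes. -/
noncomputable def expectedUtility {O : Type*} [Fintype O] (v : O → ℝ) (P : PMF O) : ℝ :=
  ∑ o, (P o).toReal * v o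

namespace DirectMechanism

/-- The lottery over outcomes that participant `i` faces when reporting `t` while the types
reported by the other `n - 1` participants are drawn independently from `m` (the `i`-th
coordinate of the drawn profile is overwritten by `t`). -/
noncomputable def interim {T O : Type*} [Fintype T] (Φ : DirectMechanism T O) (m : PMF T)
    (n : ℕ) (i : Fin n) (t : T) : PMF O :=
  (iidProfile m n).bind fun τ => (Φ n (Function.update τ i t)).map fun μ => μ i

/-- The mechanism treats participants symmetrically: relabelling the participants relabels
the outcomes. With types `T = G × A`, where the group in `G` is observed by the mechanism,
this is semi-anonymity. -/
def IsSemiAnonymous {G A O : Type*} (Φ : DirectMechanism (G × A) O) : Prop :=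
  ∀ (n : ℕ) (τ : Fin n → G × A) (ρ : Equiv.Perm (Fin n)) (μ : Fin n → O),
    Φ n (τ ∘ ρ) (μ ∘ ρ) = Φ n τ μ

/-- Strategy-proofness in the large for semi-anonymous mechanisms: against any full-support
i.i.d. distribution of the other participants' reports, in large enough markets no
participant gains more than `ε` by misreporting within her group. -/
def IsStrategyProofInTheLarge {G A O : Type*} [Fintype G] [Fintype A] [Fintype O]
    (Φ : DirectMechanism (G × A) O) (u : G × A → O → ℝ) : Prop :=
  ∀ m : PMF (G × A), (∀ t, m t ≠ 0) → ∀ ε : ℝ, 0 < ε →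
    ∃ n₀ : ℕ, ∀ n, n₀ ≤ n → ∀ (i : Fin n) (g : G) (a a' : A),
      expectedUtility (u (g, a)) (Φ.interim m n i (g, a')) - ε ≤
        expectedUtility (u (g, a)) (Φ.interim m n i (g, a))

end DirectMechanism

/-! ### School choice and the capacity expansion problem -/

/-- A strict preference order over the schools and `∅` (`none`), encoded by the position of
each alternative, position `0` being the most preferred. -/
abbrev Pref (C : Type*) [Fintype C] := Option C ≃ Fin (Fintype.card C + 1)

namespace Pref

/-- `a ≻ b`. -/
def Prefers {C : Type*} [Fintype C] (p : Pref C) (a b : Option C) : Prop := p a < p b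

/-- The rank of an alternative; the most preferred one has rank `1`. -/
def rank {C : Type*} [Fintype C] (p : Pref C) (a : Option C) : ℕ := (p a : ℕ) + 1

end Pref

/-- An instance `⟨S, C, ≻, q⟩` of the school choice problem; `higher c s s'` is `s ≻_c s'`. -/
structure SchoolChoice (S C : Type*) [Fintype C] where
  pref : S → Pref C
  higher : C → S → S → Prop
  cap : C → ℕ

namespace SchoolChoice

variable {S C : Type*} [Fintype S] [Fintype C] [DecidableEq C]

/-- The pair `(s, c)` is feasible: `s` lists `c`. -/
def Acceptable (Γ : SchoolChoice S C) (s : S) (c : C) : Prop :=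
  (Γ.pref s).Prefers (some c) none

/-- The number of students assigned to `c`. -/
def load (μ : S → Option C) (c : C) : ℕ := (Finset.univ.filter fun s => μ s = some c).card

/-- Students are assigned to listed schools or to `none`, and capacities are respected. -/
def IsMatching (Γ : SchoolChoice S C) (μ : S → Option C) : Prop :=
  (∀ s c, μ s = some c → Γ.Acceptable s c) ∧ ∀ c, load μ c ≤ Γ.cap c

def IsBlockingPair (Γ : SchoolChoice S C) (μ : S → Option C) (s : S) (c : C) : Prop :=
  Γ.Acceptable s c ∧ (Γ.pref s).Prefers (some c) (μ s) ∧
    (load μ c < Γ.cap c ∨ ∃ s', μ s' = some c ∧ Γ.higher c s s')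

def IsStable (Γ : SchoolChoice S C) (μ : S → Option C) : Prop :=
  Γ.IsMatching μ ∧ ∀ s c, ¬ Γ.IsBlockingPair μ s c

/-- The instance `Γ_t`, with `t c` additional seats at each school `c`. -/
def expand (Γ : SchoolChoice S C) (t : C → ℕ) : SchoolChoice S C where
  pref := Γ.pref
  higher := Γ.higher
  cap := fun c => Γ.cap c + t c

/-- Sum of the ranks of the assigned schools and of the penalties of unassigned students. -/
def cost (Γ : SchoolChoice S C) (penalty : S → ℝ) (μ : S → Option C) : ℝ :=
  ∑ s, match μ s with
    | none => penalty s
    | some c => ((Γ.pref s).rank (some c) : ℝ)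

/-- `(t, μ)` is feasible for the capacity expansion problem with budget `B`. -/
def IsFeasiblePlan (Γ : SchoolChoice S C) (B : ℕ) (t : C → ℕ) (μ : S → Option C) : Prop :=
  ∑ c, t c ≤ B ∧ (Γ.expand t).IsStable μ

/-- `(t, μ)` is an optimal solution of the capacity expansion problem with budget `B`. -/
def IsOptimalPlan (Γ : SchoolChoice S C) (B : ℕ) (penalty : S → ℝ) (t : C → ℕ)
    (μ : S → Option C) : Prop :=
  Γ.IsFeasiblePlan B t μ ∧
    ∀ t' μ', Γ.IsFeasiblePlan B t' μ' → Γ.cost penalty μ ≤ Γ.cost penalty μ'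

end SchoolChoice

/-! ### The capacity-planning mechanism -/

/-- The data fixed by the planner, for each number `n` of students. `G` is the set of
priority groups, and a type is a pair (group, preference). Each school strictly ranks pairs
(group, lottery number), and inside a group a higher lottery number is better at every
school. The penalties may depend on the students and on their types. -/
structure PlanningEnv (G C : Type*) [Fintype C] where
  cap : ℕ → C → ℕ
  budget : ℕ → ℕ
  penalty : (n : ℕ) → (Fin n → G × Pref C) → Fin n → ℝ
  higher : ℕ → C → G × I → G × I → Prop
  higher_strictTotal : ∀ n c, IsStrictTotalOrder (G × I) (higher n c)
  higher_group : ∀ n c g l l', higher n c (g, l) (g, l') ↔ l' < l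

/-- The instance given by a profile `τ` of groups and reported preferences and a profile `l`
of lottery numbers. -/
def PlanningEnv.toSchoolChoice {G C : Type*} [Fintype C] (E : PlanningEnv G C) {n : ℕ}
    (τ : Fin n → G × Pref C) (l : Fin n → I) : SchoolChoice (Fin n) C where
  pref := fun s => (τ s).2
  higher := fun c s s' => E.higher n c ((τ s).1, l s) ((τ s').1, l s')
  cap := E.cap n

/-- A method that solves the capacity expansion problem. Optimal solutions need not be
unique: `assign n τ l` is a possibly degenerate lottery over assignments that belong to
optimal solutions, and this choice does not depend on the names of the students. Lottery
numbers are almost surely distinct, and nothing is required where two of them coincide. -/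
structure CapacityPlanningMechanism {G C : Type*} [Fintype C] [DecidableEq C]
    (E : PlanningEnv G C) where
  assign : (n : ℕ) → (Fin n → G × Pref C) → (Fin n → I) → PMF (Fin n → Option C)
  measurable_assign : ∀ n τ μ, Measurable fun l => assign n τ l μ
  optimal : ∀ n τ l, Function.Injective l → ∀ μ ∈ (assign n τ l).support,
    ∃ t, (E.toSchoolChoice τ l).IsOptimalPlan (E.budget n) (E.penalty n τ) t μ
  nameless : ∀ n τ l, Function.Injective l → ∀ (ρ : Equiv.Perm (Fin n)) μ,
    assign n (τ ∘ ρ) (l ∘ ρ) (μ ∘ ρ) = assign n τ l μ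

/-- The direct mechanism obtained by drawing the lottery numbers independently and uniformly
from `[0, 1]`. -/
noncomputable def CapacityPlanningMechanism.toDirect {G C : Type*} [Fintype C]
    [DecidableEq C] {E : PlanningEnv G C} (M : CapacityPlanningMechanism E) :
    DirectMechanism (G × Pref C) (Option C) :=
  fun n τ => PMF.ofFintype (fun μ => ∫⁻ l : Fin n → I, M.assign n τ l μ) (by
    rw [← lintegral_finsetSum _ fun μ _ => M.measurable_assign n τ μ]
    have h : ∀ l, ∑ μ, M.assign n τ l μ = 1 := fun l => by
      rw [← tsum_fintype (L := .unconditional _)]; exact (M.assign n τ l).tsum_coe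
    simp [h])

/-!
Semi-anonymity holds because the choice among optimal plans ignores names and the law of the i.i.d.
lottery numbers is invariant under permutations; ties have probability zero.

Strategy-proofness in the large rests on two facts. First, a stable matching leaves no envy towards
a student of the same group with a worse lottery number: such a student is ranked lower by every
school (`CapacityPlanningMechanism.not_prefers_of_lottery_lt`). How the seats were chosen is
irrelevant. Secondly, absence of this kind of envy already makes misreports unprofitable in the
limit (`expectedUtility_interim_sub_le`), as follows.

Draw all `n` types independently from `m`, together with the lottery numbers. The interim utility
of participant `i` from reporting `t` is her expected payoff conditional on the draw giving her the
type `t` (`mul_expectedUtility_interim`), so no perturbation of the empirical distribution has to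
be considered. Cut `[0, 1]` into `K + 1` cells. Every participant of type `t` in cell `k + 1` weakly
prefers her lot to that of every participant of type `t'` in cell `k`. Adding this up over all such
pairs gives an inequality between products of a total payoff and a head count. The head counts are
within `√n` of their means (`integral_abs_count_sub_le`), and by exchangeability the total payoffs
are `n` times those of participant `i`; hence, conditionally on the cells, type `t` in cell `k + 1`
does at least as well as type `t'` in cell `k` up to `O(K ^ 2 / √n)`
(`measureReal_mul_integral_le_of_pairwise_le`). Averaging over `k`, and bounding the
lowest cell of `t` and the highest one of `t'` trivially, the gain from misreporting is
`O(1 / K + K ^ 2 / √n)`. Full support keeps the constants finite; a fine grid and then a large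
market make the bound smaller than `ε`.
-/

/-! ### Pairwise comparisons among exchangeable participants -/

section Exchangeable

variable {X : Type*} [MeasurableSpace X] {n : ℕ} (ν : Measure X) [IsProbabilityMeasure ν]

/-- The number of `n` independent draws that fall into `A` deviates from its mean by at most `√n`
in `L¹`, its variance being at most `n`. -/
theorem integral_abs_count_sub_le {A : Set X} (hA : MeasurableSet A) :
    ∫ ω : Fin n → X, |∑ j, A.indicator (fun _ => (1 : ℝ)) (ω j) - n * ν.real A|
      ∂(Measure.pi fun _ => ν) ≤ √n := by
  rcases Nat.eq_zero_or_pos n with rfl | hn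
  · simp
  set P : Measure (Fin n → X) := Measure.pi fun _ => ν
  have hs : (0 : ℝ) < √n := by positivity
  have hind : Measurable (A.indicator fun _ => (1 : ℝ)) := measurable_const.indicator hA
  have hb : ∀ x, A.indicator (fun _ => (1 : ℝ)) x ∈ Set.Icc (0 : ℝ) 1 := fun x => by
    by_cases hx : x ∈ A <;> simp [hx]
  have hL : MemLp (A.indicator fun _ => (1 : ℝ)) 2 ν :=
    memLp_of_bounded (.of_forall hb) hind.aestronglyMeasurable 2
  have hLP : MemLp (fun ω : Fin n → X => ∑ j, A.indicator (fun _ => (1 : ℝ)) (ω j)) 2 P :=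
    memLp_finsetSum _ fun j _ =>
      hL.comp_measurePreserving (measurePreserving_eval (fun _ : Fin n => ν) j)
  have hmean : ∫ ω, ∑ j, A.indicator (fun _ => (1 : ℝ)) (ω j) ∂P = n * ν.real A := by
    rw [integral_finsetSum]
    · have : ∀ j : Fin n, ∫ ω, A.indicator (fun _ => (1 : ℝ)) (ω j) ∂P = ν.real A := fun j => by
        rw [integral_comp_eval (μ := fun _ : Fin n => ν)
          (f := A.indicator fun _ => (1 : ℝ)) hind.aestronglyMeasurable]
        simp [integral_indicator hA]
      simp [this]
    · exact fun j _ => (hL.comp_measurePreserving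
        (measurePreserving_eval (fun _ : Fin n => ν) j)).integrable one_le_two
  have hvar : ∫ ω, (∑ j, A.indicator (fun _ => (1 : ℝ)) (ω j) - n * ν.real A) ^ 2 ∂P ≤ n := by
    rw [← hmean, ← ProbabilityTheory.variance_eq_integral hLP.1.aemeasurable]
    have h := ProbabilityTheory.variance_sum_pi (μ := fun _ : Fin n => ν)
      (X := fun _ => A.indicator fun _ => (1 : ℝ)) fun _ => hL
    have h' : (∑ j : Fin n, fun ω : Fin n → X => A.indicator (fun _ => (1 : ℝ)) (ω j))
        = fun ω => ∑ j, A.indicator (fun _ => (1 : ℝ)) (ω j) := by ext; simp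
    rw [h'] at h
    rw [h]
    have := ProbabilityTheory.variance_le_sq_of_bounded (μ := ν) (.of_forall hb) hind.aemeasurable
    simp only [Finset.sum_const, Finset.card_univ, Fintype.card_fin, nsmul_eq_mul]
    have hn' : (0 : ℝ) ≤ n := by positivity
    nlinarith
  have hY : MemLp (fun ω => ∑ j, A.indicator (fun _ => (1 : ℝ)) (ω j) - n * ν.real A) 2 P :=
    hLP.sub (memLp_const _)
  calc _ ≤ ∫ ω, ((∑ j, A.indicator (fun _ => (1 : ℝ)) (ω j) - n * ν.real A) ^ 2 / √n + √n) / 2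
        ∂P := by
        refine integral_mono (hY.integrable one_le_two).abs
          (((hY.integrable_sq.div_const _).add (integrable_const _)).div_const _) fun ω => ?_
        -- `2 |y| ≤ y ^ 2 / √n + √n`
        dsimp only
        set y := ∑ j, A.indicator (fun _ => (1 : ℝ)) (ω j) - n * ν.real A
        rw [le_div_iff₀ two_pos, div_add' _ _ _ hs.ne', le_div_iff₀ hs]
        nlinarith [sq_nonneg (|y| - √n), sq_abs y]
    _ = ((∫ ω, (∑ j, A.indicator (fun _ => (1 : ℝ)) (ω j) - n * ν.real A) ^ 2 ∂P) / √n + √n) / 2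
        := by
        rw [integral_div, integral_add (hY.integrable_sq.div_const _) (integrable_const _),
          integral_div]
        simp
    _ ≤ (n / √n + √n) / 2 := by gcongr
    _ = √n := by rw [Real.div_sqrt]; ring

/-- If participants with data in `A` are always at least as well off as those with data in `A'`,
and the participants are exchangeable, then the expected payoff on `A` per unit of probability is,
up to an error of order `1 / √n`, at least the one on `A'` (both sides are multiplied by
`ν A * ν A'`).

Summed over all pairs of a participant in `A` and one in `A'`, the hypothesis compares products of a
total payoff and a random count; replacing the count by its mean costs at most `√n` in `L¹`. -/
theorem measureReal_mul_integral_le_of_pairwise_le {W : Fin n → (Fin n → X) → ℝ} {V : ℝ}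
    (hW : ∀ i, Measurable (W i)) (hV : ∀ i ω, |W i ω| ≤ V)
    {A A' : Set X} (hA : MeasurableSet A) (hA' : MeasurableSet A')
    (hle : ∀ᵐ ω ∂(Measure.pi fun _ => ν), ∀ s s', ω s ∈ A → ω s' ∈ A' → W s' ω ≤ W s ω)
    (hex : ∀ B : Set X, MeasurableSet B → ∀ i j,
      ∫ ω, B.indicator (fun _ => (1 : ℝ)) (ω i) * W i ω ∂(Measure.pi fun _ => ν) =
        ∫ ω, B.indicator (fun _ => (1 : ℝ)) (ω j) * W j ω ∂(Measure.pi fun _ => ν))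
    (i : Fin n) :
    ν.real A * ∫ ω, A'.indicator (fun _ => (1 : ℝ)) (ω i) * W i ω ∂(Measure.pi fun _ => ν) ≤
      ν.real A' * ∫ ω, A.indicator (fun _ => (1 : ℝ)) (ω i) * W i ω ∂(Measure.pi fun _ => ν) +
        2 * V / √n := by
  have hn : 0 < n := i.pos
  set P : Measure (Fin n → X) := Measure.pi fun _ => ν
  have hV0 : 0 ≤ V := (abs_nonneg _).trans (hV i fun j => (ν.nonempty_of_neZero).some)
  have hm : ∀ {B : Set X}, MeasurableSet B → ∀ j,
      Measurable fun ω : Fin n → X => B.indicator (fun _ => (1 : ℝ)) (ω j) := fun hB j =>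
    (measurable_const.indicator hB).comp (measurable_pi_apply j)
  have hi : ∀ (B : Set X) (x : X), |B.indicator (fun _ => (1 : ℝ)) x| ≤ 1 := fun B x => by
    by_cases hx : x ∈ B <;> simp [hx]
  -- the total payoff of the participants in `B` and their number
  let S : Set X → (Fin n → X) → ℝ := fun B ω => ∑ j, B.indicator (fun _ => (1 : ℝ)) (ω j) * W j ω
  let N : Set X → (Fin n → X) → ℝ := fun B ω => ∑ j, B.indicator (fun _ => (1 : ℝ)) (ω j)
  have hterm : ∀ (B : Set X) (j : Fin n) (ω : Fin n → X),
      |B.indicator (fun _ => (1 : ℝ)) (ω j) * W j ω| ≤ V := fun B j ω => by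
    rw [abs_mul]
    exact (mul_le_mul (hi B _) (hV j ω) (abs_nonneg _) zero_le_one).trans_eq (one_mul V)
  have hSm : ∀ {B}, MeasurableSet B → Measurable (S B) := fun hB =>
    Finset.measurable_fun_sum _ fun j _ => (hm hB j).mul (hW j)
  have hNm : ∀ {B}, MeasurableSet B → Measurable (N B) := fun hB =>
    Finset.measurable_fun_sum _ fun j _ => hm hB j
  have hSb : ∀ B ω, |S B ω| ≤ n * V := fun B ω => by
    refine (Finset.abs_sum_le_sum_abs _ _).trans ?_
    exact (Finset.sum_le_sum (g := fun _ => V) fun j _ => hterm B j ω).trans (by simp)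
  have hNb : ∀ B ω, |N B ω| ≤ n := fun B ω => by
    refine (Finset.abs_sum_le_sum_abs _ _).trans ?_
    exact (Finset.sum_le_sum (g := fun _ => 1) fun j _ => hi B _).trans (by simp)
  have hint : ∀ {f : (Fin n → X) → ℝ} {c : ℝ}, Measurable f → (∀ ω, |f ω| ≤ c) →
      Integrable f P := fun hf hc =>
    Integrable.of_bound hf.aestronglyMeasurable _ (.of_forall hc)
  have hSi : ∀ {B}, MeasurableSet B → Integrable (S B) P := fun hB => hint (hSm hB) (hSb _)
  have hRi : ∀ {B}, MeasurableSet B → Integrable (fun ω => |N B ω - n * ν.real B|) P := fun hB =>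
    ((hint (hNm hB) (hNb _)).sub (integrable_const _)).abs
  have hS : ∀ {B}, MeasurableSet B →
      ∫ ω, S B ω ∂P = n * ∫ ω, B.indicator (fun _ => (1 : ℝ)) (ω i) * W i ω ∂P := fun {B} hB => by
    simp only [S]
    rw [integral_finsetSum _ fun j _ =>
      hint (f := fun ω => _ * _) ((hm hB j).mul (hW j)) (hterm B j),
      Finset.sum_congr rfl fun j _ => hex B hB j i]
    simp
  have key : ∀ᵐ ω ∂P, n * ν.real A * S A' ω ≤ n * ν.real A' * S A ω +
      n * V * (|N A ω - n * ν.real A| + |N A' ω - n * ν.real A'|) := by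
    filter_upwards [hle] with ω h
    -- the sum of `W s' ≤ W s` over all pairs `s` in `A`, `s'` in `A'`
    have h1 : N A ω * S A' ω ≤ N A' ω * S A ω := by
      simp only [N, S]
      rw [Finset.sum_mul_sum, Finset.sum_mul_sum, Finset.sum_comm]
      refine Finset.sum_le_sum fun s' _ => Finset.sum_le_sum fun s _ => ?_
      by_cases hs : ω s ∈ A <;> by_cases hs' : ω s' ∈ A' <;> simp [hs, hs']
      exact h s s' hs hs'
    have h2 := abs_le.1 (abs_mul (N A ω - n * ν.real A) (S A' ω) |>.le.trans
      (mul_le_mul_of_nonneg_left (hSb A' ω) (abs_nonneg _)))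
    have h3 := abs_le.1 (abs_mul (N A' ω - n * ν.real A') (S A ω) |>.le.trans
      (mul_le_mul_of_nonneg_left (hSb A ω) (abs_nonneg _)))
    linarith [h2.1, h3.2]
  have hRR : Integrable (fun ω => |N A ω - n * ν.real A| + |N A' ω - n * ν.real A'|) P :=
    (hRi hA).add (hRi hA')
  have hI : n * ν.real A * ∫ ω, S A' ω ∂P ≤ n * ν.real A' * ∫ ω, S A ω ∂P +
      n * V * (∫ ω, |N A ω - n * ν.real A| ∂P + ∫ ω, |N A' ω - n * ν.real A'| ∂P) := by
    rw [← integral_const_mul, ← integral_const_mul, ← integral_add (hRi hA) (hRi hA'),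
      ← integral_const_mul, ← integral_add ((hSi hA).const_mul _) (hRR.const_mul _)]
    exact integral_mono_ae ((hSi hA').const_mul _)
      (((hSi hA).const_mul _).add (hRR.const_mul _)) key
  rw [hS hA, hS hA'] at hI
  have e1 := integral_abs_count_sub_le (n := n) ν hA
  have e2 := integral_abs_count_sub_le (n := n) ν hA'
  have hn' : (0 : ℝ) < n := by exact_mod_cast hn
  have hsq : √(n : ℝ) * √n = n := Real.mul_self_sqrt hn'.le
  have hs : (0 : ℝ) < √n := by positivity
  have h4 := mul_le_mul_of_nonneg_left (add_le_add e1 e2) (mul_nonneg hn'.le hV0)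
  have h5 : n * V * (√n + √n) = n * n * (2 * V / √n) := by
    rw [mul_div_assoc', eq_div_iff hs.ne']
    linear_combination 2 * n * V * hsq
  have h6 := hI.trans (add_le_add_right (h4.trans_eq h5) _)
  refine le_of_mul_le_mul_left ?_ (mul_pos hn' hn')
  linarith [h6]

end Exchangeable

/-! ### Independent lottery numbers -/

section Lottery

theorem volume_floor_mul_eq {K k : ℕ} (hk : k < K) :
    (volume : Measure I).real {l : I | ⌊K * (l : ℝ)⌋₊ = k} = 1 / K := by
  have hK : (0 : ℝ) < K := by exact_mod_cast (Nat.zero_le k).trans_lt hk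
  have hk' : (k : ℝ) + 1 ≤ K := by exact_mod_cast hk
  have h1 : (k : ℝ) / K ∈ I := ⟨by positivity, (div_le_one hK).2 (by linarith)⟩
  have h2 : ((k : ℝ) + 1) / K ∈ I := ⟨by positivity, (div_le_one hK).2 hk'⟩
  have : {l : I | ⌊K * (l : ℝ)⌋₊ = k} = Set.Ico ⟨_, h1⟩ ⟨_, h2⟩ := by
    ext l
    have hl : 0 ≤ (K : ℝ) * l := mul_nonneg hK.le l.2.1
    rw [Set.mem_ofPred_eq, Nat.floor_eq_iff hl]
    simp only [Set.mem_Ico, ← Subtype.coe_le_coe, ← Subtype.coe_lt_coe,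
      div_le_iff₀ hK, lt_div_iff₀ hK, mul_comm (K : ℝ)]
  rw [this, Measure.real, unitInterval.volume_Ico, ENNReal.toReal_ofReal] <;>
    · simp only []
      rw [← sub_div]
      simp

theorem measurable_floor_mul (K : ℕ) : Measurable fun l : I => ⌊K * (l : ℝ)⌋₊ :=
  Nat.measurable_floor.comp (measurable_subtype_coe.const_mul _)

theorem ae_injective_pi {Y : Type*} [MeasurableSpace Y] [MeasurableEq Y]
    (ν : Measure Y) [IsProbabilityMeasure ν] [NullSingletonClass ν] (n : ℕ) :
    ∀ᵐ l ∂(Measure.pi fun _ : Fin n => ν), Function.Injective l := by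
  have h : ∀ i j : Fin n, i ≠ j → ∀ᵐ l ∂(Measure.pi fun _ : Fin n => ν), l i ≠ l j := by
    intro i j hij
    have hind := (ProbabilityTheory.iIndepFun_pi (μ := fun _ : Fin n => ν) (X := fun _ y => y)
      fun _ => aemeasurable_id).indepFun hij
    have hmap := (ProbabilityTheory.indepFun_iff_map_prod_eq_prod_map_map
      (measurable_pi_apply i).aemeasurable (measurable_pi_apply j).aemeasurable).1 hind
    have hi : ∀ i, (Measure.pi fun _ : Fin n => ν).map (fun l => l i) = ν := fun i =>
      (measurePreserving_eval (fun _ : Fin n => ν) i).map_eq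
    rw [hi, hi] at hmap
    have hd : (ν.prod ν) (Set.diagonal Y) = 0 := by
      rw [Measure.measure_prod_null measurableSet_diagonal]
      refine .of_forall fun y => ?_
      have : Prod.mk y ⁻¹' Set.diagonal Y = {y} := by ext z; simp [eq_comm]
      simp [this]
    rw [← hmap, Measure.map_apply (by fun_prop) measurableSet_diagonal] at hd
    exact measure_eq_zero_iff_ae_notMem.1 hd
  have h' : ∀ᵐ l ∂(Measure.pi fun _ : Fin n => ν), ∀ i j : Fin n, i ≠ j → l i ≠ l j :=
    ae_all_iff.2 fun i => ae_all_iff.2 fun j => by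
      by_cases hij : i = j
      · simp [hij]
      · simpa [hij] using h i j hij
  filter_upwards [h'] with l hl i j hij
  by_contra hne
  exact hl i j hne hij

theorem measurePreserving_comp_perm {Y : Type*} [MeasurableSpace Y] (ν : Measure Y)
    [SigmaFinite ν] {n : ℕ} (ρ : Equiv.Perm (Fin n)) :
    MeasurePreserving (MeasurableEquiv.piCongrLeft (fun _ => Y) ρ.symm)
      (Measure.pi fun _ : Fin n => ν) (Measure.pi fun _ => ν) :=
  measurePreserving_piCongrLeft (fun _ : Fin n => ν) ρ.symm

theorem piCongrLeft_symm_eq_comp {Y : Type*} [MeasurableSpace Y] {n : ℕ}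
    (ρ : Equiv.Perm (Fin n)) (l : Fin n → Y) :
    MeasurableEquiv.piCongrLeft (fun _ => Y) ρ.symm l = l ∘ ρ := by
  ext i
  simpa using MeasurableEquiv.piCongrLeft_apply_apply ρ.symm (β := fun _ => Y) l (ρ i)

end Lottery

/-! ### Expected utility and i.i.d. profiles -/

section ExpectedUtility

theorem expectedUtility_bind {A O : Type*} [Fintype A] [Fintype O] (v : O → ℝ) (P : PMF A)
    (f : A → PMF O) :
    expectedUtility v (P.bind f) = ∑ a, (P a).toReal * expectedUtility v (f a) := by
  simp only [expectedUtility, PMF.bind_apply, tsum_fintype, Finset.mul_sum]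
  rw [Finset.sum_comm]
  refine Finset.sum_congr rfl fun o _ => ?_
  rw [ENNReal.toReal_sum fun a _ => ENNReal.mul_ne_top (P.apply_ne_top a) ((f a).apply_ne_top o),
    Finset.sum_mul]
  simp [mul_assoc]

theorem expectedUtility_map {A O : Type*} [Fintype A] [Fintype O] (v : O → ℝ) (P : PMF A)
    (f : A → O) : expectedUtility v (P.map f) = expectedUtility (fun a => v (f a)) P := by
  classical
  rw [← PMF.bind_pure_comp, expectedUtility_bind]
  refine Finset.sum_congr rfl fun a _ => ?_
  simp [expectedUtility, PMF.pure_apply, apply_ite ENNReal.toReal]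

theorem sum_toReal_eq_one {O : Type*} [Fintype O] (P : PMF O) : ∑ o, (P o).toReal = 1 := by
  rw [← ENNReal.toReal_sum fun o _ => P.apply_ne_top o,
    ← tsum_fintype (L := .unconditional O), P.tsum_coe, ENNReal.toReal_one]

theorem abs_expectedUtility_le {O : Type*} [Fintype O] {v : O → ℝ} {V : ℝ} (hv : ∀ o, |v o| ≤ V)
    (P : PMF O) : |expectedUtility v P| ≤ V := by
  calc _ ≤ ∑ o, |(P o).toReal * v o| := Finset.abs_sum_le_sum_abs _ _
    _ ≤ ∑ o, (P o).toReal * V := Finset.sum_le_sum fun o _ => by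
        rw [abs_mul, abs_of_nonneg ENNReal.toReal_nonneg]
        exact mul_le_mul_of_nonneg_left (hv o) ENNReal.toReal_nonneg
    _ = V := by rw [← Finset.sum_mul, sum_toReal_eq_one, one_mul]

theorem expectedUtility_mono {O : Type*} [Fintype O] {v w : O → ℝ} {P : PMF O}
    (h : ∀ o ∈ P.support, v o ≤ w o) : expectedUtility v P ≤ expectedUtility w P := by
  refine Finset.sum_le_sum fun o _ => ?_
  by_cases ho : o ∈ P.support
  · exact mul_le_mul_of_nonneg_left (h o ho) ENNReal.toReal_nonneg
  · simp [(P.apply_eq_zero_iff o).2 ho]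

theorem iidProfile_toReal {T : Type*} [Fintype T] (m : PMF T) {n : ℕ} (τ : Fin n → T) :
    (iidProfile m n τ).toReal = ∏ j, (m (τ j)).toReal := by
  simp [iidProfile, ENNReal.toReal_prod]

/-- Resampling one coordinate: conditioning an i.i.d. profile on its `i`-th entry being `t` is
the same as overwriting that entry by `t`. -/
theorem mul_sum_iidProfile_update {T : Type*} [Fintype T] [DecidableEq T] (m : PMF T) {n : ℕ}
    (i : Fin n) (t : T) (F : (Fin n → T) → ℝ) :
    (m t).toReal * ∑ τ, (iidProfile m n τ).toReal * F (Function.update τ i t) =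
      ∑ τ, (iidProfile m n τ).toReal * if τ i = t then F τ else 0 := by
  -- exchange the `i`-th entry of `τ` with an independent draw `s`
  let e : (Fin n → T) × T → (Fin n → T) × T := fun x => (Function.update x.1 i x.2, x.1 i)
  have he : Function.Involutive e := fun x => by simp [e]
  have hw : ∀ x, (iidProfile m n (e x).1).toReal * (m (e x).2).toReal =
      (iidProfile m n x.1).toReal * (m x.2).toReal := fun x => by
    simp only [iidProfile_toReal, e]
    rw [← Finset.mul_prod_erase _ _ (Finset.mem_univ i),
      ← Finset.mul_prod_erase Finset.univ (fun j => (m (x.1 j)).toReal) (Finset.mem_univ i),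
      Finset.prod_congr rfl fun j hj => by
        rw [Function.update_of_ne (Finset.ne_of_mem_erase hj)]]
    simp only [Function.update_self]
    ring
  have h := Equiv.sum_comp he.toPerm fun x : (Fin n → T) × T =>
    (iidProfile m n x.1).toReal * (m x.2).toReal * if x.1 i = t then F x.1 else 0
  simp only [Function.Involutive.coe_toPerm, hw, Fintype.sum_prod_type] at h
  calc _ = ∑ τ, ∑ s, (iidProfile m n τ).toReal * (m s).toReal *
        if (e (τ, s)).1 i = t then F (e (τ, s)).1 else 0 := by
        rw [Finset.mul_sum]
        refine Finset.sum_congr rfl fun τ _ => ?_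
        simp only [e, Function.update_self, mul_ite, mul_zero, Finset.sum_ite_eq', Finset.mem_univ,
          if_true]
        ring
    _ = _ := h
    _ = _ := Finset.sum_congr rfl fun τ _ => by
        rw [← Finset.sum_mul, ← Finset.mul_sum, sum_toReal_eq_one, mul_one]

end ExpectedUtility

/-! ### Absence of envy towards worse lottery numbers in large markets -/

section Payoff

variable {T O : Type*} [Fintype O] {n : ℕ}

/-- The expected utility of participant `i` in a rule `x` that uses lottery numbers, where
`ω j` is the pair of the type and the lottery number of participant `j`. -/
noncomputable def payoff (v : O → ℝ) (x : (Fin n → T) → (Fin n → I) → PMF (Fin n → O))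
    (i : Fin n) (ω : Fin n → T × I) : ℝ :=
  expectedUtility (fun μ => v (μ i)) (x (fun j => (ω j).1) fun j => (ω j).2)

variable {v : O → ℝ} {x : (Fin n → T) → (Fin n → I) → PMF (Fin n → O)}

theorem measurable_expectedUtility (hx : ∀ τ μ, Measurable fun l => x τ l μ)
    (w : (Fin n → O) → ℝ) (τ : Fin n → T) : Measurable fun l => expectedUtility w (x τ l) :=
  Finset.measurable_fun_sum _ fun μ _ => (hx τ μ).ennreal_toReal.mul_const _

theorem payoff_comp_perm
    (hs : ∀ τ l, Function.Injective l → ∀ (ρ : Equiv.Perm (Fin n)) μ,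
      x (τ ∘ ρ) (l ∘ ρ) (μ ∘ ρ) = x τ l μ)
    (ρ : Equiv.Perm (Fin n)) (i : Fin n) {ω : Fin n → T × I}
    (hω : Function.Injective fun j => (ω j).2) :
    payoff v x i (ω ∘ ρ) = payoff v x (ρ i) ω := by
  classical
  refine (Equiv.sum_comp (ρ.symm.arrowCongr (Equiv.refl O)) _).symm.trans ?_
  refine Finset.sum_congr rfl fun μ _ => ?_
  have : (ρ.symm.arrowCongr (Equiv.refl O)) μ = μ ∘ ρ := by ext; simp
  rw [this]
  exact congrArg (fun p : ENNReal => p.toReal * v (μ (ρ i))) (hs (fun j => (ω j).1) _ hω ρ μ)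

/-- Exchangeability: the expected payoff on the event that a participant's type and lottery number
lie in `B` is the same for all participants. -/
theorem integral_indicator_mul_payoff_eq [MeasurableSpace T]
    (hs : ∀ τ l, Function.Injective l → ∀ (ρ : Equiv.Perm (Fin n)) μ,
      x (τ ∘ ρ) (l ∘ ρ) (μ ∘ ρ) = x τ l μ)
    (m : PMF T) (B : Set (T × I)) (i j : Fin n) :
    ∫ ω, B.indicator (fun _ => (1 : ℝ)) (ω i) * payoff v x i ω
        ∂(Measure.pi fun _ => m.toMeasure.prod volume) =
      ∫ ω, B.indicator (fun _ => (1 : ℝ)) (ω j) * payoff v x j ω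
        ∂(Measure.pi fun _ => m.toMeasure.prod volume) := by
  rw [← (measurePreserving_comp_perm (m.toMeasure.prod volume) (Equiv.swap i j)).integral_comp']
  refine integral_congr_ae ?_
  have hsnd := measurePreserving_pi (fun _ : Fin n => m.toMeasure.prod (volume : Measure I))
    (fun _ => volume) fun _ => measurePreserving_snd
  filter_upwards [hsnd.quasiMeasurePreserving.ae (ae_injective_pi volume n)] with ω hω
  rw [piCongrLeft_symm_eq_comp, payoff_comp_perm hs _ _ hω]
  simp

variable [Fintype T] [MeasurableSpace T] [DiscreteMeasurableSpace T]

theorem measurable_payoff (hx : ∀ τ μ, Measurable fun l => x τ l μ) (i : Fin n) :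
    Measurable (payoff v x i) := by
  have h : Measurable fun p : (Fin n → T) × (Fin n → I) =>
      expectedUtility (fun μ => v (μ i)) (x p.1 p.2) :=
    measurable_from_prod_countable_right fun τ => measurable_expectedUtility hx _ τ
  exact h.comp (g := fun p : (Fin n → T) × (Fin n → I) => _) (by fun_prop :
    Measurable fun ω : Fin n → T × I => ((fun j => (ω j).1, fun j => (ω j).2) : _ × _))

theorem integral_pi_prod_eq_sum (m : PMF T) {f : (Fin n → T) → (Fin n → I) → ℝ} {V : ℝ}
    (hf : ∀ τ, Measurable (f τ)) (hV : ∀ τ l, |f τ l| ≤ V) :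
    ∫ ω : Fin n → T × I, f (fun j => (ω j).1) (fun j => (ω j).2)
      ∂(Measure.pi fun _ => m.toMeasure.prod volume) =
    ∑ τ, (iidProfile m n τ).toReal * ∫ l, f τ l := by
  classical
  have h := (measurePreserving_arrowProdEquivProdArrow T I (Fin n) (fun _ => m.toMeasure)
    fun _ => volume).integral_comp' fun p : (Fin n → T) × (Fin n → I) => f p.1 p.2
  refine h.trans ?_
  have hm : Measurable fun p : (Fin n → T) × (Fin n → I) => f p.1 p.2 :=
    measurable_from_prod_countable_right hf
  rw [integral_prod _ (Integrable.of_bound hm.aestronglyMeasurable V (.of_forall fun p => hV _ _)),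
    integral_fintype .of_finite]
  refine Finset.sum_congr rfl fun τ _ => ?_
  rw [iidProfile_toReal, ← Set.univ_pi_singleton, Measure.real, Measure.pi_pi,
    ENNReal.toReal_prod, smul_eq_mul]
  simp only [m.toMeasure_apply_singleton _ (measurableSet_singleton _)]
  rfl

/-- The interim utility of participant `i` from the report `t` is, up to the factor `m t`, her
payoff on the event that an i.i.d. draw gives her the type `t`. -/
theorem mul_expectedUtility_interim {Φ : DirectMechanism T O}
    (hx : ∀ τ μ, Measurable fun l => x τ l μ) (hΦ : ∀ τ μ, Φ n τ μ = ∫⁻ l, x τ l μ)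
    (m : PMF T) (i : Fin n) (t : T) :
    (m t).toReal * expectedUtility v (Φ.interim m n i t) =
      ∫ ω, (Prod.fst ⁻¹' {t}).indicator (fun _ => (1 : ℝ)) (ω i) * payoff v x i ω
        ∂(Measure.pi fun _ => m.toMeasure.prod volume) := by
  classical
  obtain ⟨V, hV⟩ : ∃ V, ∀ o, |v o| ≤ V :=
    ⟨∑ o, |v o|, fun o => Finset.single_le_sum (fun o _ => abs_nonneg (v o)) (Finset.mem_univ o)⟩
  have hb : ∀ τ l, |expectedUtility (fun μ => v (μ i)) (x τ l)| ≤ V := fun τ l =>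
    abs_expectedUtility_le (v := fun μ : Fin n → O => v (μ i)) (fun μ => hV (μ i)) _
  have hΦ' : ∀ τ, expectedUtility (fun μ => v (μ i)) (Φ n τ) =
      ∫ l, expectedUtility (fun μ => v (μ i)) (x τ l) := fun τ => by
    simp only [expectedUtility]
    have hle : ∀ μ, ∀ l, x τ l μ ≤ 1 := fun μ l => PMF.coe_le_one _ _
    rw [integral_finsetSum]
    · refine Finset.sum_congr rfl fun μ _ => ?_
      rw [integral_mul_const, hΦ, integral_toReal (hx τ μ).aemeasurable
        (.of_forall fun l => PMF.apply_lt_top _ _)]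
    · refine fun μ _ => Integrable.mul_const ?_ _
      refine Integrable.of_bound (hx τ μ).ennreal_toReal.aestronglyMeasurable 1
        (.of_forall fun l => ?_)
      rw [Real.norm_of_nonneg ENNReal.toReal_nonneg]
      exact ENNReal.toReal_le_of_le_ofReal zero_le_one (by simpa using hle μ l)
  rw [DirectMechanism.interim, expectedUtility_bind]
  simp only [expectedUtility_map, hΦ']
  rw [mul_sum_iidProfile_update m i t fun τ => ∫ l, expectedUtility (fun μ => v (μ i)) (x τ l)]
  have hV0 : ∀ τ l, |(if τ i = t then 1 else 0) *
      expectedUtility (fun μ => v (μ i)) (x τ l)| ≤ V := fun τ l => by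
    split_ifs
    · simpa using hb τ l
    · simpa using (abs_nonneg _).trans (hb τ l)
  have h := integral_pi_prod_eq_sum m (f := fun τ l => (if τ i = t then 1 else 0) *
    expectedUtility (fun μ => v (μ i)) (x τ l))
    (fun τ => (measurable_expectedUtility hx _ τ).const_mul _) hV0
  refine Eq.trans ?_ (h.symm.trans ?_)
  · refine Finset.sum_congr rfl fun τ _ => ?_
    split_ifs <;> simp
  · refine integral_congr_ae (.of_forall fun ω => ?_)
    simp [payoff, Set.indicator_apply]

/-- **No envy towards worse lottery numbers makes misreports unprofitable on average.**
Participants of type `t` whose lottery number falls into a cell of a grid of mesh `1 / K` do not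
envy participants of type `t'` in the cell below. The two boundary cells cost the first error
term, the fluctuation of the numbers of participants in the cells the second one. -/
theorem expectedUtility_interim_sub_le {Φ : DirectMechanism T O}
    (hx : ∀ τ μ, Measurable fun l => x τ l μ) (hΦ : ∀ τ μ, Φ n τ μ = ∫⁻ l, x τ l μ)
    (hs : ∀ τ l, Function.Injective l → ∀ (ρ : Equiv.Perm (Fin n)) μ,
      x (τ ∘ ρ) (l ∘ ρ) (μ ∘ ρ) = x τ l μ)
    {t t' : T} (henvy : ∀ τ l, Function.Injective l → ∀ μ ∈ (x τ l).support, ∀ s s',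
      τ s = t → τ s' = t' → l s' < l s → v (μ s') ≤ v (μ s))
    {V : ℝ} (hV : ∀ o, |v o| ≤ V) (m : PMF T) (i : Fin n) (K : ℕ) :
    (m t).toReal * (m t').toReal * (expectedUtility v (Φ.interim m n i t') -
        expectedUtility v (Φ.interim m n i t)) ≤
      2 * V * (m t).toReal * (m t').toReal / (K + 1) + 2 * V * (K + 1) ^ 2 / √n := by
  set ν : Measure (T × I) := m.toMeasure.prod volume
  set P : Measure (Fin n → T × I) := Measure.pi fun _ => ν
  have hK : (0 : ℝ) < K + 1 := by positivity
  have hW : ∀ j, Measurable (payoff v x j) := fun j => measurable_payoff hx j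
  have hWV : ∀ j ω, |payoff v x j ω| ≤ V := fun j ω =>
    abs_expectedUtility_le (v := fun μ : Fin n → O => v (μ j)) (fun μ => hV (μ j)) _
  have hV0 : 0 ≤ V := (abs_nonneg _).trans (hWV i fun _ => ((m.support_nonempty).some, 0))
  -- type `r` with a lottery number in the `k`-th cell
  let B : T → ℕ → Set (T × I) := fun r k => {r} ×ˢ {l : I | ⌊((K + 1 : ℕ) : ℝ) * l⌋₊ = k}
  have hBm : ∀ r k, MeasurableSet (B r k) := fun r k =>
    (measurableSet_singleton r).prod (measurable_floor_mul (K + 1) (measurableSet_singleton k))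
  have hBν : ∀ r k, k < K + 1 → ν.real (B r k) = (m r).toReal / (K + 1) := fun r k hk => by
    rw [measureReal_prod_prod, volume_floor_mul_eq hk, Measure.real,
      m.toMeasure_apply_singleton _ (measurableSet_singleton _)]
    push_cast
    ring
  let J : T → ℕ → ℝ := fun r k =>
    ∫ ω, (B r k).indicator (fun _ => (1 : ℝ)) (ω i) * payoff v x i ω ∂P
  have hind : ∀ r k, Measurable fun ω : Fin n → T × I =>
      (B r k).indicator (fun _ => (1 : ℝ)) (ω i) := fun r k =>
    (measurable_const.indicator (hBm r k)).comp (measurable_pi_apply i)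
  have hpt : ∀ r k (ω : Fin n → T × I), |(B r k).indicator (fun _ => (1 : ℝ)) (ω i) *
      payoff v x i ω| ≤ V * (B r k).indicator (fun _ => (1 : ℝ)) (ω i) := fun r k ω => by
    by_cases h : ω i ∈ B r k <;> simp [h, hWV]
  have hi : ∀ r k, Integrable (fun ω => (B r k).indicator (fun _ => (1 : ℝ)) (ω i)) P :=
    fun r k => Integrable.of_bound (hind r k).aestronglyMeasurable 1 (.of_forall fun ω => by
      by_cases h : ω i ∈ B r k <;> simp [h])
  have hJi : ∀ r k, Integrable (fun ω => (B r k).indicator (fun _ => (1 : ℝ)) (ω i) *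
      payoff v x i ω) P := fun r k =>
    ((hi r k).const_mul V).mono' ((hind r k).mul (hW i)).aestronglyMeasurable
      (.of_forall (hpt r k))
  have hJb : ∀ r k, k < K + 1 → |J r k| ≤ V * ((m r).toReal / (K + 1)) := fun r k hk => by
    calc |J r k| ≤ ∫ ω, V * (B r k).indicator (fun _ => (1 : ℝ)) (ω i) ∂P :=
          norm_integral_le_of_norm_le (f := fun ω => (B r k).indicator (fun _ => (1 : ℝ)) (ω i) *
            payoff v x i ω) ((hi r k).const_mul V) (.of_forall (hpt r k))
      _ = _ := by
          rw [integral_const_mul, integral_comp_eval (μ := fun _ : Fin n => ν)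
            (f := (B r k).indicator fun _ => (1 : ℝ))
            (measurable_const.indicator (hBm r k)).aestronglyMeasurable,
            integral_indicator_const _ (hBm r k), hBν r k hk]
          simp
  have hJs : ∀ r, (m r).toReal * expectedUtility v (Φ.interim m n i r) =
      ∑ k ∈ Finset.range (K + 1), J r k := fun r => by
    rw [mul_expectedUtility_interim hx hΦ, ← integral_finsetSum _ fun k _ => hJi r k]
    refine integral_congr_ae ?_
    have h1 : ∀ᵐ l : I, l ≠ 1 := Measure.ae_ne volume 1
    have h2 := ((measurePreserving_snd (μ := m.toMeasure) (ν := (volume : Measure I))).comp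
      (measurePreserving_eval (fun _ : Fin n => ν) i)).quasiMeasurePreserving.ae h1
    -- almost surely exactly one cell contains the lottery number; only `1` lies outside all cells
    filter_upwards [h2] with ω hω
    have hlt : ⌊((K + 1 : ℕ) : ℝ) * ((ω i).2 : ℝ)⌋₊ < K + 1 := by
      have h0 : (0 : ℝ) < ((K + 1 : ℕ) : ℝ) := by positivity
      rw [Nat.floor_lt (mul_nonneg h0.le (ω i).2.2.1)]
      exact mul_lt_of_lt_one_right h0 (unitInterval.lt_one_iff_ne_one.2 hω)
    rw [← Finset.sum_mul]
    congr 1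
    by_cases hr : (ω i).1 = r
    · have hB : ∀ k, (B r k).indicator (fun _ => (1 : ℝ)) (ω i) =
          if ⌊((K + 1 : ℕ) : ℝ) * ((ω i).2 : ℝ)⌋₊ = k then 1 else 0 := fun k => by
        classical
        rw [Set.indicator_apply]
        exact if_congr ⟨fun h => h.2, fun h => ⟨hr, h⟩⟩ rfl rfl
      rw [Finset.sum_congr rfl fun k _ => hB k, Finset.sum_ite_eq, if_pos (Finset.mem_range.2 hlt)]
      exact Set.indicator_of_mem (s := Prod.fst ⁻¹' {r}) hr _
    · have hB : ∀ k, (B r k).indicator (fun _ => (1 : ℝ)) (ω i) = 0 := fun k =>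
        Set.indicator_of_notMem (fun h => hr h.1) _
      rw [Finset.sum_eq_zero fun k _ => hB k]
      exact Set.indicator_of_notMem (s := Prod.fst ⁻¹' {r}) hr _
  have hstep : ∀ k, k < K →
      (m t).toReal * J t' k ≤ (m t').toReal * J t (k + 1) + 2 * V * (K + 1) / √n := fun k hk => by
    have hsnd := measurePreserving_pi (fun _ : Fin n => m.toMeasure.prod (volume : Measure I))
      (fun _ => volume) fun _ => measurePreserving_snd
    have h := measureReal_mul_integral_le_of_pairwise_le ν hW hWV (hBm t (k + 1)) (hBm t' k)
      (by
        filter_upwards [hsnd.quasiMeasurePreserving.ae (ae_injective_pi volume n)]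
          with ω hω s s' hS hS'
        refine expectedUtility_mono fun μ hμ => henvy _ _ hω μ hμ s s' hS.1 hS'.1 ?_
        -- a higher cell means a better lottery number
        by_contra! hle
        have hfl : ⌊((K + 1 : ℕ) : ℝ) * ((ω s).2 : ℝ)⌋₊ ≤ ⌊((K + 1 : ℕ) : ℝ) * ((ω s').2 : ℝ)⌋₊ :=
          Nat.floor_le_floor (mul_le_mul_of_nonneg_left hle (by positivity))
        have e1 : ⌊((K + 1 : ℕ) : ℝ) * ((ω s).2 : ℝ)⌋₊ = k + 1 := hS.2
        have e2 : ⌊((K + 1 : ℕ) : ℝ) * ((ω s').2 : ℝ)⌋₊ = k := hS'.2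
        omega)
      (fun C _ j j' => integral_indicator_mul_payoff_eq hs m C j j') i
    rw [hBν t _ (by omega), hBν t' _ (by omega)] at h
    have h' := mul_le_mul_of_nonneg_left h hK.le
    refine (Eq.le ?_).trans (h'.trans_eq ?_) <;>
      · simp only [J, P]
        field_simp
  have h1 := hJs t
  have h2 := hJs t'
  rw [Finset.sum_range_succ'] at h1
  rw [Finset.sum_range_succ] at h2
  have h3 := Finset.sum_le_sum fun k hk => hstep k (Finset.mem_range.1 hk)
  rw [Finset.sum_add_distrib, ← Finset.mul_sum, ← Finset.mul_sum, Finset.sum_const,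
    Finset.card_range, nsmul_eq_mul] at h3
  have hmt : 0 ≤ (m t).toReal := ENNReal.toReal_nonneg
  have hmt' : 0 ≤ (m t').toReal := ENNReal.toReal_nonneg
  have h4 := mul_le_mul_of_nonneg_left (abs_le.1 (hJb t 0 (by omega))).1 hmt'
  have h5 := mul_le_mul_of_nonneg_left (abs_le.1 (hJb t' K (by omega))).2 hmt
  have h6 : (K : ℝ) * (2 * V * (K + 1) / √n) ≤ 2 * V * (K + 1) ^ 2 / √n := by
    rw [mul_div_assoc']
    refine div_le_div_of_nonneg_right ?_ (Real.sqrt_nonneg _)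
    nlinarith [mul_nonneg hV0 hK.le]
  have h7 : 2 * V * (m t).toReal * (m t').toReal / (K + 1) =
      (m t).toReal * (V * ((m t').toReal / (K + 1))) +
        (m t').toReal * (V * ((m t).toReal / (K + 1))) := by ring
  have h8 := congrArg ((m t').toReal * ·) h1
  have h9 := congrArg ((m t).toReal * ·) h2
  simp only [mul_add] at h8 h9
  rw [h7]
  linarith

end Payoff

/-! ### Capacity-planning mechanisms -/

/-- A stable matching leaves no justified envy: a student whom every school ranks above `s'`
does not prefer the assignment of `s'`. -/
theorem SchoolChoice.IsStable.not_prefers_of_higher {S C : Type*} [Fintype S] [Fintype C]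
    [DecidableEq C] {Γ : SchoolChoice S C} {μ : S → Option C} (h : Γ.IsStable μ) {s s' : S}
    (hs : ∀ c, Γ.higher c s s') : ¬ (Γ.pref s).Prefers (μ s') (μ s) := by
  intro hp
  -- `s` is weakly better off than when unassigned
  have hir : Γ.pref s (μ s) ≤ Γ.pref s none := by
    cases hμ : μ s with
    | none => exact le_rfl
    | some c => exact (h.1.1 s c hμ).le
  cases hμ' : μ s' with
  | none => rw [hμ'] at hp; exact hir.not_gt hp
  | some c =>
    rw [hμ'] at hp
    exact h.2 s c ⟨lt_of_lt_of_le hp hir, hp, .inr ⟨s', hμ', hs c⟩⟩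

/-- Within a group nobody envies a student with a worse lottery number, whatever the capacities
chosen, since an optimal plan consists of a stable matching for the expanded capacities. -/
theorem CapacityPlanningMechanism.not_prefers_of_lottery_lt {G C : Type*} [Fintype C]
    [DecidableEq C] {E : PlanningEnv G C} (M : CapacityPlanningMechanism E) {n : ℕ}
    {τ : Fin n → G × Pref C} {l : Fin n → I} (hl : Function.Injective l)
    {μ : Fin n → Option C} (hμ : μ ∈ (M.assign n τ l).support) {s s' : Fin n}
    (hg : (τ s').1 = (τ s).1) (hlt : l s' < l s) : ¬ (τ s).2.Prefers (μ s') (μ s) := by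
  obtain ⟨t, ⟨⟨-, hst⟩, -⟩⟩ := M.optimal n τ l hl μ hμ
  refine hst.not_prefers_of_higher fun c => ?_
  change E.higher n c ((τ s).1, l s) ((τ s').1, l s')
  rw [hg]
  exact (E.higher_group n c _ _ _).2 hlt

theorem CapacityPlanningMechanism.toDirect_apply {G C : Type*} [Fintype C]
    [DecidableEq C] {E : PlanningEnv G C} (M : CapacityPlanningMechanism E) (n : ℕ)
    (τ : Fin n → G × Pref C) (μ : Fin n → Option C) :
    M.toDirect n τ μ = ∫⁻ l, M.assign n τ l μ := by
  simp [toDirect]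

theorem CapacityPlanningMechanism.isSemiAnonymous_toDirect {G C : Type*} [Fintype C]
    [DecidableEq C] {E : PlanningEnv G C} (M : CapacityPlanningMechanism E) :
    M.toDirect.IsSemiAnonymous := by
  intro n τ ρ μ
  rw [M.toDirect_apply, M.toDirect_apply]
  -- i.i.d. lottery numbers may be relabelled along with the types
  refine ((measurePreserving_comp_perm (volume : Measure I) ρ).lintegral_comp_emb
    (MeasurableEquiv.measurableEmbedding _) fun l => M.assign n (τ ∘ ρ) l (μ ∘ ρ)).symm.trans ?_
  refine lintegral_congr_ae ?_
  filter_upwards [ae_injective_pi (volume : Measure I) n] with l hl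
  rw [piCongrLeft_symm_eq_comp]
  exact M.nameless n τ l hl ρ μ

theorem CapacityPlanningMechanism.isStrategyProofInTheLarge_toDirect {G C : Type*} [Fintype G]
    [Fintype C] [DecidableEq C] {E : PlanningEnv G C} (M : CapacityPlanningMechanism E)
    (u : G × Pref C → Option C → ℝ)
    (hu : ∀ g p a b, u (g, p) b < u (g, p) a ↔ p.Prefers a b) :
    M.toDirect.IsStrategyProofInTheLarge u := by
  intro m hm ε hε
  -- finitely many groups and preferences: it suffices to treat each pair of reports separately
  suffices h : ∀ (g : G) (a a' : Pref C), ∀ᶠ n in Filter.atTop, ∀ i : Fin n,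
      expectedUtility (u (g, a)) (M.toDirect.interim m n i (g, a')) - ε ≤
        expectedUtility (u (g, a)) (M.toDirect.interim m n i (g, a)) by
    obtain ⟨n₀, hn₀⟩ := Filter.eventually_atTop.1 (Filter.eventually_all.2 fun g =>
      Filter.eventually_all.2 fun a => Filter.eventually_all.2 fun a' => h g a a')
    exact ⟨n₀, fun n hn i g a a' => hn₀ n hn g a a' i⟩
  intro g a a'
  let _ : MeasurableSpace (G × Pref C) := ⊤
  have : DiscreteMeasurableSpace (G × Pref C) := ⟨fun _ => trivial⟩
  obtain ⟨V, hV⟩ : ∃ V, ∀ o, |u (g, a) o| ≤ V := ⟨∑ o, |u (g, a) o|, fun o =>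
    Finset.single_le_sum (fun o _ => abs_nonneg (u (g, a) o)) (Finset.mem_univ o)⟩
  have hpos : ∀ t, 0 < (m t).toReal := fun t => ENNReal.toReal_pos (hm t) (m.apply_ne_top t)
  set w : ℝ := (m (g, a)).toReal * (m (g, a')).toReal with hw
  have hw0 : 0 < w := mul_pos (hpos _) (hpos _)
  -- a grid so fine that its boundary cells cost less than `ε / 2`
  obtain ⟨K, hK⟩ := exists_nat_gt (2 * V / (ε / 2))
  have hK' : 2 * V / (K + 1) ≤ ε / 2 := by
    rw [div_le_iff₀ (by positivity)]
    rw [div_lt_iff₀ (by positivity)] at hK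
    nlinarith
  have hlim : Filter.Tendsto (fun n : ℕ => 2 * V * (K + 1) ^ 2 / √(n : ℝ)) Filter.atTop (nhds 0) :=
    (Real.tendsto_sqrt_atTop.comp tendsto_natCast_atTop_atTop).const_div_atTop _
  filter_upwards [hlim.eventually_lt_const (show 0 < w * (ε / 2) by positivity)] with n hn i
  have h := expectedUtility_interim_sub_le (v := u (g, a)) (t := (g, a)) (t' := (g, a'))
    (M.measurable_assign n) (M.toDirect_apply n) (M.nameless n)
    (fun τ l hl μ hμ s s' hs hs' hlt => by
      have hnp := M.not_prefers_of_lottery_lt hl hμ (by rw [hs, hs']) hlt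
      rw [hs] at hnp
      exact le_of_not_gt fun hgt => hnp ((hu g a _ _).1 hgt)) hV m i K
  have h1 : 2 * V * (m (g, a)).toReal * (m (g, a')).toReal / (K + 1) = w * (2 * V / (K + 1)) := by
    rw [hw]; ring
  rw [h1, ← hw] at h
  have h2 := mul_le_mul_of_nonneg_left hK' hw0.le
  have h3 := le_of_mul_le_mul_left (h.trans (by linarith : _ ≤ w * ε)) hw0
  linarith

theorem mainTheorem8 {G C : Type*} [Fintype G] [Fintype C] [DecidableEq C]
    (E : PlanningEnv G C) (M : CapacityPlanningMechanism E)
    (u : G × Pref C → Option C → ℝ)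
    (hu : ∀ g p a b, u (g, p) b < u (g, p) a ↔ p.Prefers a b) :
    M.toDirect.IsSemiAnonymous ∧ M.toDirect.IsStrategyProofInTheLarge u :=
  ⟨M.isSemiAnonymous_toDirect, M.isStrategyProofInTheLarge_toDirect u hu⟩
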